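/- For $n\ge 1$ let $Q_n$ be the $n$-dimensional hypercube graph: its vertices are the binary strings of length $n$, two of them being adjacent if and only if they differ in exactly one coordinate. A labeling of the vertices of a graph $G$ with two labels is called $2$-distinguishing if only the trivial automorphism of $G$ preserves the labels, and $G$ is $2$-distinguishable if it has such a labeling. For a finite $2$-distinguishable graph $G$, the cost of $2$-distinguishing $\rho(G)$ is the minimum size of a label class over all $2$-distinguishing labelings of $G$. The determining number $\mathrm{Det}(G)$ of a finite graph $G$ is the size of a smallest set of vertices whose pointwise stabilizer in $\mathrm{Aut}(G)$ is trivial. For every $n\ge 5$, the hypercube $Q_n$ is $2$-distinguishable and $$\rho(Q_n)\in\{\mathrm{Det}(Q_n),\ \mathrm{Det}(Q_n)+1\}.$$ -/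

import Mathlib

namespace SimpleGraph

/-- The hypercube `Q_n`: the vertices are the binary strings of length `n`, and two of them are
adjacent if and only if they differ in exactly one coordinate. -/
def hypercube (n : ℕ) : SimpleGraph (Fin n → Bool) where
  Adj u v := hammingDist u v = 1
  symm := ⟨fun u v h => by rwa [hammingDist_comm]⟩
  loopless := ⟨fun u h => by simp at h⟩

/-- A labeling `c` of the vertices of `G` with `d` labels is `d`-distinguishing if only the trivial
automorphism of `G` preserves the labels. -/
def IsDistinguishingLabeling {V : Type*} (G : SimpleGraph V) {d : ℕ} (c : V → Fin d) : Prop :=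
  ∀ φ : G ≃g G, (∀ v, c (φ v) = c v) → φ = RelIso.refl G.Adj

/-- `G` is `d`-distinguishable if it has a `d`-distinguishing labeling. -/
def IsDistinguishable {V : Type*} (G : SimpleGraph V) (d : ℕ) : Prop :=
  ∃ c : V → Fin d, G.IsDistinguishingLabeling c

/-- The cost `ρ(G)` of 2-distinguishing a finite graph `G`: the minimum size of a label class over
all 2-distinguishing labelings of `G` (it is meaningful when `G` is 2-distinguishable). -/
noncomputable def distinguishingCost {V : Type*} (G : SimpleGraph V) : ℕ :=
  sInf {k | ∃ c : V → Fin 2, G.IsDistinguishingLabeling c ∧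
    ∃ (i : Fin 2) (S : Finset V), (∀ v, v ∈ S ↔ c v = i) ∧ S.card = k}

/-- The determining number `Det(G)` of a finite graph `G`: the size of a smallest set of vertices
whose pointwise stabilizer in the automorphism group of `G` is trivial. -/
noncomputable def determiningNumber {V : Type*} (G : SimpleGraph V) : ℕ :=
  sInf {k | ∃ S : Finset V,
    (∀ φ : G ≃g G, (∀ v ∈ S, φ v = v) → φ = RelIso.refl G.Adj) ∧ S.card = k}

end SimpleGraph

namespace SimpleGraph

/-! Put `m = ⌈log₂ n⌉`; the proof shows `m + 1 ≤ Det ≤ ρ ≤ m + 2`. Write `N` vertices as the rows of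
a matrix with `n` columns. Automorphisms of `Q_n` are signed coordinate permutations, so the rows of
a determining set have columns distinct up to complement, whence `n ≤ 2 ^ (N - 1)`
(`le_two_pow_of_determining`). A class of a distinguishing labeling is determining, so `Det ≤ ρ`.
For the upper bound, `N = m + 2` rows suffice once the columns, modulo complement, form a family
with no nontrivial row symmetry (`exists_distinguishing_of_columns`). Such a family encodes a path
on the rows with a marked end, and its other members are free outside a small forbidden collection
(`exists_rigid_family`). -/

/-! ### Automorphisms of the hypercube -/

theorem hypercube_adj {n : ℕ} {u v : Fin n → Bool} :
    (hypercube n).Adj u v ↔ hammingDist u v = 1 := Iff.rfl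

/-- The automorphism of the hypercube that permutes the coordinates by `σ` and then flips the
coordinates marked by `b`. -/
def hypercubeAut {n : ℕ} (σ : Equiv.Perm (Fin n)) (b : Fin n → Bool) :
    hypercube n ≃g hypercube n where
  toFun x i := xor (x (σ i)) (b i)
  invFun x i := xor (x (σ.symm i)) (b (σ.symm i))
  left_inv x := by ext i; simp
  right_inv x := by ext i; simp
  map_rel_iff' := by
    intro x y
    simp only [hypercube_adj, hammingDist, Equiv.coe_fn_mk]
    rw [Finset.card_equiv (t := {i | x i ≠ y i}) σ (by simp)]

theorem hypercubeAut_apply {n : ℕ} (σ : Equiv.Perm (Fin n)) (b x : Fin n → Bool) (i : Fin n) :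
    hypercubeAut σ b x i = xor (x (σ i)) (b i) := rfl

theorem hammingDist_hypercubeHom_le {n : ℕ} (φ : hypercube n →g hypercube n)
    (x y : Fin n → Bool) : hammingDist (φ x) (φ y) ≤ hammingDist x y := by
  induction hd : hammingDist x y generalizing x with
  | zero => rw [hammingDist_eq_zero.1 hd]; simp
  | succ k ih =>
    obtain ⟨i, hi⟩ : ∃ i, x i ≠ y i := by
      by_contra! h
      rw [funext h, hammingDist_self] at hd
      omega
    have h1 : hammingDist x (Function.update x i (y i)) = 1 := by
      rw [hammingDist, Finset.card_eq_one]
      refine ⟨i, ?_⟩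
      ext j
      by_cases hj : j = i
      · subst hj; simpa using hi
      · simp [hj]
    have h2 : hammingDist (Function.update x i (y i)) y = k := by
      have : ({j | Function.update x i (y i) j ≠ y j} : Finset (Fin n)) =
          ({j | x j ≠ y j} : Finset (Fin n)).erase i := by
        ext j
        by_cases hj : j = i
        · subst hj; simp
        · simp [hj]
      rw [hammingDist, this, Finset.card_erase_of_mem (by simpa using hi)]
      rw [hammingDist] at hd
      omega
    have h3 := ih _ h2
    have h4 : hammingDist (φ x) (φ (Function.update x i (y i))) = 1 := φ.map_adj h1
    have := hammingDist_triangle (φ x) (φ (Function.update x i (y i))) (φ y)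
    omega

theorem hammingDist_hypercubeIso {n : ℕ} (φ : hypercube n ≃g hypercube n)
    (x y : Fin n → Bool) : hammingDist (φ x) (φ y) = hammingDist x y := by
  refine le_antisymm (hammingDist_hypercubeHom_le φ.toHom x y) ?_
  simpa using hammingDist_hypercubeHom_le φ.symm.toHom (φ x) (φ y)

/-- Reads a coordinate of `x` off distances alone, so an isometry is determined by the images of one
vertex and its neighbours. -/
theorem hammingDist_update_not_lt_iff {n : ℕ} (x a : Fin n → Bool) (i : Fin n) :
    hammingDist x (Function.update a i (!a i)) < hammingDist x a ↔ x i ≠ a i := by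
  have aux : ∀ b : Fin n → Bool, hammingDist x b =
      (({j | x j ≠ b j} : Finset (Fin n)).erase i).card + if x i ≠ b i then 1 else 0 := by
    intro b
    split_ifs with h
    · rw [Finset.card_erase_add_one (by simpa using h)]; rfl
    · rw [Finset.erase_eq_of_notMem (by simpa using h)]; rfl
  have h : ({j | x j ≠ Function.update a i (!a i) j} : Finset (Fin n)).erase i =
      ({j | x j ≠ a j} : Finset (Fin n)).erase i := by
    ext j
    by_cases hj : j = i
    · simp [hj]
    · simp [hj]
  rw [aux, aux a, h]
  cases x i <;> cases a i <;> simp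

theorem exists_eq_update_not_of_hammingDist_eq_one {n : ℕ} {a y : Fin n → Bool}
    (h : hammingDist a y = 1) : ∃ i, y = Function.update a i (!a i) := by
  obtain ⟨i, hi⟩ := Finset.card_eq_one.1 h
  refine ⟨i, funext fun j => ?_⟩
  have hj : a j ≠ y j ↔ j = i := by
    simpa using congrArg (j ∈ ·) hi
  by_cases hji : j = i
  · subst hji
    have := hj.2 rfl
    simp only [Function.update_self]
    cases h1 : a j <;> cases h2 : y j <;> simp_all
  · simp only [Function.update_of_ne hji]
    by_contra hne
    exact hji (hj.1 (Ne.symm hne))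

/-- Every automorphism of the hypercube is a signed permutation of the coordinates. -/
theorem exists_perm_of_hypercubeIso {n : ℕ} (φ : hypercube n ≃g hypercube n) :
    ∃ (σ : Fin n → Fin n) (b : Fin n → Bool), ∀ x i, φ x (σ i) = xor (x i) (b i) := by
  have hex : ∀ i : Fin n, ∃ j, φ (Function.update (fun _ => false) i true) =
      Function.update (φ fun _ => false) j (!φ (fun _ => false) j) := fun i => by
    refine exists_eq_update_not_of_hammingDist_eq_one ?_
    rw [hammingDist_hypercubeIso, hammingDist, Finset.card_eq_one]
    refine ⟨i, ?_⟩
    ext j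
    by_cases hj : j = i
    · subst hj; simp
    · simp [hj]
  choose σ hσ using hex
  refine ⟨σ, fun i => φ (fun _ => false) (σ i), fun x i => ?_⟩
  have h1 := hammingDist_update_not_lt_iff (φ x) (φ fun _ => false) (σ i)
  rw [← hσ, hammingDist_hypercubeIso, hammingDist_hypercubeIso] at h1
  have h2 := hammingDist_update_not_lt_iff x (fun _ => false) i
  have h3 := h1.symm.trans h2
  beta_reduce
  generalize φ x (σ i) = p, φ (fun _ => false) (σ i) = q, x i = t at h3 ⊢
  revert p q t
  decide

/-! ### Lower bound for the determining number -/

/-- A determining set of `Q_n` separates the coordinates up to complementation. -/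
theorem le_two_pow_of_determining {n : ℕ} (hn : 2 ≤ n) (S : Finset (Fin n → Bool))
    (hS : ∀ φ : hypercube n ≃g hypercube n, (∀ v ∈ S, φ v = v) →
      φ = RelIso.refl (hypercube n).Adj) : n ≤ 2 ^ (S.card - 1) := by
  by_contra! hlt
  obtain ⟨i, j, hij, c, hc⟩ : ∃ i j : Fin n, i ≠ j ∧ ∃ c : Bool, ∀ s ∈ S, xor (s i) (s j) = c := by
    rcases S.eq_empty_or_nonempty with rfl | ⟨s₀, hs₀⟩
    · exact ⟨⟨0, by omega⟩, ⟨1, by omega⟩, by simp, true, by simp⟩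
    -- Adding the row `s₀` to all rows normalizes columns modulo complement and leaves `card - 1`
    -- free bits for the pigeonhole.
    · obtain ⟨i, j, hij, h⟩ := Fintype.exists_ne_map_eq_of_card_lt
        (fun (i : Fin n) (s : S.erase s₀) => xor (s.1 i) (s₀ i))
        (by
          rw [Fintype.card_fun, Fintype.card_bool, Fintype.card_coe, Finset.card_erase_of_mem hs₀,
            Fintype.card_fin]
          exact hlt)
      refine ⟨i, j, hij, xor (s₀ i) (s₀ j), fun s hs => ?_⟩
      by_cases hss : s = s₀
      · rw [hss]
      · have := congrFun h ⟨s, Finset.mem_erase.2 ⟨hss, hs⟩⟩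
        revert this
        simp only
        cases s i <;> cases s j <;> cases s₀ i <;> cases s₀ j <;> simp
  -- Swapping columns `i` and `j`, and flipping both if they are complementary, fixes every row in
  -- `S`.
  have h := hS (hypercubeAut (Equiv.swap i j) fun k => decide (k = i ∨ k = j) && c) fun s hs => by
    funext k
    rw [hypercubeAut_apply, ← hc s hs]
    by_cases hki : k = i
    · subst hki; cases h1 : s k <;> cases h2 : s j <;> simp [h2]
    · by_cases hkj : k = j
      · subst hkj; cases h1 : s i <;> cases h2 : s k <;> simp [h1]
      · simp [hki, hkj, Equiv.swap_apply_of_ne_of_ne hki hkj]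
  have h' := congrFun (congrArg (fun ψ : hypercube n ≃g hypercube n =>
    ψ (Function.update (fun _ => false) i (!c))) h) i
  rw [hypercubeAut_apply] at h'
  simp [hij.symm] at h'

/-! ### From rigid set families to labelings -/

/-- If the columns of a matrix are pairwise different up to complementation and no nontrivial
permutation of the rows preserves the set of columns up to complementation, then the set of rows
is a class of a distinguishing labeling. -/
theorem exists_distinguishing_of_columns {n N : ℕ} (F : Fin n → Finset (Fin N))
    (hF : ∀ i j, F i = F j ∨ F i = (F j)ᶜ → i = j)
    (hF' : ∀ i, F i ≠ (F i)ᶜ)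
    (hrigid : ∀ π : Equiv.Perm (Fin N),
      (∀ i, ∃ j, (F i).map π.toEmbedding = F j ∨ (F i).map π.toEmbedding = (F j)ᶜ) → π = 1) :
    ∃ c : (Fin n → Bool) → Fin 2, (hypercube n).IsDistinguishingLabeling c ∧
      ∃ (i : Fin 2) (S : Finset (Fin n → Bool)), (∀ v, v ∈ S ↔ c v = i) ∧ S.card = N := by
  classical
  let row : Fin N → Fin n → Bool := fun r i => decide (r ∈ F i)
  have hrow : Function.Injective row := by
    intro r r' h
    have hmem : ∀ i, r ∈ F i ↔ r' ∈ F i := fun i => by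
      simpa [row] using congrFun h i
    -- Transposing two equal rows preserves every column, so rigidity makes the rows distinct.
    have hswap := hrigid (Equiv.swap r r') fun i => ⟨i, Or.inl <| by
      ext s
      rw [Finset.mem_map_equiv, Equiv.symm_swap]
      by_cases hs : s = r
      · subst hs; simp [hmem]
      · by_cases hs' : s = r'
        · subst hs'; simp [hmem]
        · rw [Equiv.swap_apply_of_ne_of_ne hs hs']⟩
    exact Equiv.swap_eq_one_iff.1 hswap
  let S : Finset (Fin n → Bool) := Finset.univ.image row
  refine ⟨fun v => if v ∈ S then 0 else 1, fun φ hφ => ?_, 0, S, fun v => ?_, ?_⟩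
  · have hmem : ∀ r, ∃ r', φ (row r) = row r' := fun r => by
      have h1 : row r ∈ S := Finset.mem_image_of_mem _ (Finset.mem_univ _)
      have h2 : φ (row r) ∈ S := by
        by_contra hcon
        have := hφ (row r)
        simp only at this
        rw [if_pos h1, if_neg hcon] at this
        exact absurd this (by decide)
      obtain ⟨r', -, h⟩ := Finset.mem_image.1 h2
      exact ⟨r', h.symm⟩
    choose p hp using hmem
    have hpinj : Function.Injective p := fun r r' h =>
      hrow (φ.injective (by rw [hp, hp, h]))
    let π : Equiv.Perm (Fin N) := Equiv.ofBijective p (Finite.injective_iff_bijective.1 hpinj)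
    obtain ⟨σ, b, hσ⟩ := exists_perm_of_hypercubeIso φ
    have hcol : ∀ i r, p r ∈ F (σ i) ↔ (xor (decide (r ∈ F i)) (b i)) = true := fun i r => by
      have := hσ (row r) i
      rw [hp] at this
      simp only [row] at this
      rw [← this]; simp
    have hπ : π = 1 := hrigid π fun i => ⟨σ i, by
      cases hb : b i
      · left
        ext s
        obtain ⟨r, rfl⟩ := π.surjective s
        have := hcol i r
        rw [hb] at this
        simpa [π, hpinj.eq_iff] using this.symm
      · right
        ext s
        obtain ⟨r, rfl⟩ := π.surjective s
        have := hcol i r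
        rw [hb] at this
        simp [π, this]⟩
    have hp1 : ∀ r, p r = r := fun r => congrArg (fun τ : Equiv.Perm (Fin N) => τ r) hπ
    -- With the rows fixed, column `σ i` is column `i` or its complement, so nothing moves or flips.
    have hσb : ∀ i, σ i = i ∧ b i = false := fun i => by
      have h0 : F (σ i) = F i ∧ b i = false ∨ F (σ i) = (F i)ᶜ ∧ b i = true := by
        cases hb : b i
        · left
          refine ⟨?_, rfl⟩
          ext r
          have := hcol i r
          rw [hb, hp1] at this
          simpa using this
        · right
          refine ⟨?_, rfl⟩
          ext r
          have := hcol i r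
          rw [hb, hp1] at this
          simpa using this
      rcases h0 with ⟨h, hb⟩ | ⟨h, hb⟩
      · exact ⟨hF _ _ (Or.inl h), hb⟩
      · have := hF _ _ (Or.inr h)
        rw [this] at h
        exact absurd h (hF' i)
    ext x i
    have := hσ x i
    rw [(hσb i).1, (hσb i).2] at this
    simpa using this
  · by_cases hv : v ∈ S <;> simp [hv]
  · rw [Finset.card_image_of_injective _ hrow, Finset.card_univ, Fintype.card_fin]

/-! ### Rigid families built from a path -/

/-- A permutation of a path that preserves adjacency and does not send the first vertex to the last
one is trivial. -/
theorem perm_eq_one_of_path {M : ℕ} (π : Equiv.Perm (Fin (M + 1)))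
    (hadj : ∀ a b : Fin (M + 1), (a : ℕ) + 1 = b →
      (π a : ℕ) + 1 = π b ∨ (π b : ℕ) + 1 = π a)
    (h0 : π 0 ≠ Fin.last M) : π = 1 := by
  -- Injectivity forbids turning back, so the direction of the first step persists.
  have key : (∀ i : ℕ, ∀ h : i < M + 1, (π ⟨i, h⟩ : ℕ) = π 0 + i) ∨
      (∀ i : ℕ, ∀ h : i < M + 1, (π ⟨i, h⟩ : ℕ) + i = π 0) := by
    rcases Nat.eq_zero_or_pos M with rfl | hM
    · left
      intro i h
      obtain rfl : i = 0 := by omega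
      simp
    have hne : ∀ i, ∀ h : i + 1 + 1 < M + 1, (π ⟨i + 1 + 1, h⟩ : ℕ) ≠ π ⟨i, by omega⟩ := fun i h heq => by
      have := π.injective (Fin.ext heq)
      have := congrArg Fin.val this
      simp only at this
      omega
    have hstep : ∀ i, ∀ h : i + 1 < M + 1, (π ⟨i, by omega⟩ : ℕ) + 1 = π ⟨i + 1, h⟩ ∨
        (π ⟨i + 1, h⟩ : ℕ) + 1 = π ⟨i, by omega⟩ := fun i h => hadj _ _ rfl
    rcases hstep 0 (by omega) with h1 | h1
    · have hs : ∀ i, ∀ h : i + 1 < M + 1, (π ⟨i, by omega⟩ : ℕ) + 1 = π ⟨i + 1, h⟩ := by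
        intro i
        induction i with
        | zero => intro _; exact h1
        | succ i ih =>
          intro h
          have a1 := ih (by omega)
          have a2 := hstep (i + 1) h
          have a3 := hne i h
          omega
      left
      intro i
      induction i with
      | zero => intro _; rfl
      | succ i ih =>
        intro h
        have a1 := ih (by omega)
        have a2 := hs i h
        omega
    · have hs : ∀ i, ∀ h : i + 1 < M + 1, (π ⟨i + 1, h⟩ : ℕ) + 1 = π ⟨i, by omega⟩ := by
        intro i
        induction i with
        | zero => intro _; exact h1
        | succ i ih =>
          intro h
          have a1 := ih (by omega)
          have a2 := hstep (i + 1) h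
          have a3 := hne i h
          omega
      right
      intro i
      induction i with
      | zero => intro _; rfl
      | succ i ih =>
        intro h
        have a1 := ih (by omega)
        have a2 := hs i h
        omega
  rcases key with h | h
  · have hM := h M (by omega)
    ext i
    have := h i i.2
    have := (π ⟨M, by omega⟩).2
    simp only [Fin.eta] at *
    simp only [Equiv.Perm.coe_one, id]
    omega
  · exfalso
    have hM := h M (by omega)
    have := (π 0).2
    exact h0 (Fin.ext (by rw [Fin.val_last]; omega))

/-- The member of `{A, Aᶜ}` that does not contain the last element. -/
def avoidLast {M : ℕ} (A : Finset (Fin (M + 1))) : Finset (Fin (M + 1)) :=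
  if Fin.last M ∈ A then Aᶜ else A

theorem avoidLast_eq_or {M : ℕ} (A : Finset (Fin (M + 1))) :
    avoidLast A = A ∨ avoidLast A = Aᶜ := by
  unfold avoidLast; split_ifs <;> simp

theorem last_notMem_avoidLast {M : ℕ} (A : Finset (Fin (M + 1))) :
    Fin.last M ∉ avoidLast A := by
  unfold avoidLast; split_ifs with h <;> simp [h]

theorem avoidLast_of_notMem {M : ℕ} {A : Finset (Fin (M + 1))} (h : Fin.last M ∉ A) :
    avoidLast A = A := if_neg h

theorem avoidLast_compl {M : ℕ} (A : Finset (Fin (M + 1))) :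
    avoidLast Aᶜ = avoidLast A := by
  unfold avoidLast; by_cases h : Fin.last M ∈ A <;> simp [h]

theorem avoidLast_eq_avoidLast_iff {M : ℕ} {A B : Finset (Fin (M + 1))} :
    avoidLast A = avoidLast B ↔ A = B ∨ A = Bᶜ := by
  constructor
  · intro h
    rcases avoidLast_eq_or A with hA | hA <;> rcases avoidLast_eq_or B with hB | hB <;>
      rw [hA, hB] at h
    · exact Or.inl h
    · exact Or.inr h
    · exact Or.inr (by rw [← h, compl_compl])
    · exact Or.inl (compl_injective h)
  · rintro (rfl | rfl)
    · rfl
    · exact avoidLast_compl B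

theorem card_eq_or_of_avoidLast_eq {M : ℕ} {A B : Finset (Fin (M + 1))}
    (h : avoidLast A = avoidLast B) : A.card = B.card ∨ A.card + B.card = M + 1 := by
  rcases avoidLast_eq_avoidLast_iff.1 h with rfl | rfl
  · exact Or.inl rfl
  · right
    rw [Finset.card_compl_add_card, Fintype.card_fin]

/-- Bounds the forbidden sets by half of the `2 ^ M` complement classes: a larger end `j` has `j -
1` non-neighbours below it, and one singleton is added. -/
theorem sum_range_sub_one_lt_two_pow {M : ℕ} (hM : 4 ≤ M) :
    ∑ j ∈ Finset.range (M + 1), (j - 1) + 1 ≤ 2 ^ (M - 1) := by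
  induction M, hM using Nat.le_induction with
  | base => decide
  | succ M hM ih =>
    rw [Finset.sum_range_succ]
    have h1 : M + 1 ≤ 2 ^ (M - 1) + 1 := by
      have : M - 1 < 2 ^ (M - 1) := Nat.lt_two_pow_self
      omega
    have h2 : 2 ^ (M + 1 - 1) = 2 * 2 ^ (M - 1) := by
      rw [← pow_succ']; congr 1; omega
    omega

/-- Families of `n` subsets of an `(M + 1)`-set, pairwise different up to complementation, that no
nontrivial permutation preserves up to complementation. -/
theorem exists_rigid_family {n M : ℕ} (hM : 4 ≤ M) (h1 : M + 1 ≤ n) (h2 : n ≤ 2 ^ (M - 1)) :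
    ∃ 𝒢 : Finset (Finset (Fin (M + 1))), 𝒢.card = n ∧ (∀ A ∈ 𝒢, Fin.last M ∉ A) ∧
      ∀ π : Equiv.Perm (Fin (M + 1)),
        (∀ A ∈ 𝒢, avoidLast (A.map π.toEmbedding) ∈ 𝒢) → π = 1 := by
  classical
  -- The path edges, with `{0}` marking one end.
  let core : Finset (Finset (Fin (M + 1))) :=
    insert {0} (Finset.univ.image fun i : Fin M => avoidLast {i.castSucc, i.succ})
  -- Non-edges and the other end: excluding them makes any family containing `core` rigid.
  let bad : Finset (Finset (Fin (M + 1))) :=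
    insert (avoidLast {Fin.last M})
      (((Finset.range (M + 1)).sigma fun j => Finset.range (j - 1)).image
        fun p => avoidLast {Fin.ofNat (M + 1) p.2, Fin.ofNat (M + 1) p.1})
  let all : Finset (Finset (Fin (M + 1))) := (Finset.univ.erase (Fin.last M)).powerset
  have hall : ∀ A, A ∈ all ↔ Fin.last M ∉ A := fun A => by
    simp only [all, Finset.mem_powerset]
    constructor
    · intro h hA
      simpa using h hA
    · intro h x hx
      simp only [Finset.mem_erase, Finset.mem_univ, and_true]
      rintro rfl
      exact h hx
  have hallcard : all.card = 2 ^ M := by simp [all]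
  have hbadcard : bad.card ≤ 2 ^ (M - 1) := by
    refine (Finset.card_insert_le _ _).trans (le_trans ?_ (sum_range_sub_one_lt_two_pow hM))
    refine Nat.add_le_add_right (Finset.card_image_le.trans ?_) 1
    simp
  have h0last : (0 : Fin (M + 1)) ≠ Fin.last M := fun h => by
    have := congrArg Fin.val h
    simp at this
    omega
  have hpair : ∀ a b : Fin (M + 1), (a : ℕ) + 1 < b → avoidLast {a, b} ∈ bad := fun a b hab => by
    refine Finset.mem_insert_of_mem (Finset.mem_image.2 ⟨⟨b, a⟩, ?_, ?_⟩)
    · simp only [Finset.mem_sigma, Finset.mem_range]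
      have := b.2
      omega
    · simp
  have hcard2 : ∀ a b : Fin (M + 1), a ≠ b → ({a, b} : Finset (Fin (M + 1))).card = 2 :=
    fun a b h => Finset.card_pair h
  have hbad : ∀ A ∈ bad, A = avoidLast {Fin.last M} ∨
      ∃ a b : Fin (M + 1), (a : ℕ) + 1 < b ∧ A = avoidLast {a, b} := fun A hA => by
    rcases Finset.mem_insert.1 hA with h | h
    · exact Or.inl h
    · right
      obtain ⟨⟨j, i⟩, hp, rfl⟩ := Finset.mem_image.1 h
      simp only [Finset.mem_sigma, Finset.mem_range] at hp
      refine ⟨_, _, ?_, rfl⟩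
      simp only [Fin.ofNat, Nat.mod_eq_of_lt hp.1]
      rw [Nat.mod_eq_of_lt (by omega)]
      omega
  -- As `M + 1 ≥ 5`, sets of size 1 or 2 are never complements of one another.
  have hcore : core ⊆ all \ bad := by
    intro A hA
    rw [Finset.mem_sdiff, hall]
    rcases Finset.mem_insert.1 hA with rfl | hA
    · refine ⟨by simpa using h0last.symm, fun h => ?_⟩
      rw [← avoidLast_of_notMem (A := {0}) (by simpa using h0last.symm)] at h
      rcases hbad _ h with h | ⟨a, b, hab, h⟩
      · rcases avoidLast_eq_avoidLast_iff.1 h with h | h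
        · exact h0last (by simpa using h)
        · have := congrArg Finset.card h
          rw [Finset.card_compl] at this
          simp at this
          omega
      · have := card_eq_or_of_avoidLast_eq h
        rw [hcard2 a b (by rintro rfl; omega), Finset.card_singleton] at this
        omega
    · obtain ⟨i, -, rfl⟩ := Finset.mem_image.1 hA
      refine ⟨last_notMem_avoidLast _, fun h => ?_⟩
      have hi : ({i.castSucc, i.succ} : Finset (Fin (M + 1))).card = 2 :=
        hcard2 _ _ (Fin.castSucc_lt_succ).ne
      rcases hbad _ h with h | ⟨a, b, hab, h⟩
      · have := card_eq_or_of_avoidLast_eq h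
        rw [hi, Finset.card_singleton] at this
        omega
      · rcases avoidLast_eq_avoidLast_iff.1 h with h | h
        · have ha : a ∈ ({i.castSucc, i.succ} : Finset (Fin (M + 1))) := by simp [h]
          have hb : b ∈ ({i.castSucc, i.succ} : Finset (Fin (M + 1))) := by simp [h]
          simp only [Finset.mem_insert, Finset.mem_singleton, Fin.ext_iff, Fin.val_castSucc,
            Fin.val_succ] at ha hb
          omega
        · have := congrArg Finset.card h
          rw [hi, Finset.card_compl, hcard2 a b (by rintro rfl; omega), Fintype.card_fin] at this
          omega
  have hcorecard : core.card ≤ n := by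
    refine ((Finset.card_insert_le _ _).trans (Nat.add_le_add_right Finset.card_image_le 1)).trans ?_
    simpa using h1
  have hncard : n ≤ (all \ bad).card := by
    have h3 := Finset.le_card_sdiff bad all
    have h4 : 2 ^ M = 2 * 2 ^ (M - 1) := by
      rw [← pow_succ']; congr 1; omega
    omega
  obtain ⟨𝒢, hcG, hGa, hG⟩ := Finset.exists_subsuperset_card_eq hcore hcorecard hncard
  have hGbad : ∀ A ∈ 𝒢, A ∉ bad := fun A hA => (Finset.mem_sdiff.1 (hGa hA)).2
  have hnorm : ∀ (π : Equiv.Perm (Fin (M + 1))) (A : Finset (Fin (M + 1))),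
      avoidLast ((avoidLast A).map π.toEmbedding) = avoidLast (A.map π.toEmbedding) := by
    intro π A
    rw [avoidLast_eq_avoidLast_iff]
    rcases avoidLast_eq_or A with h | h <;> rw [h]
    · exact Or.inl rfl
    · right
      ext x
      simp [Finset.mem_map_equiv]
  refine ⟨𝒢, hG, fun A hA => (hall A).1 (Finset.mem_sdiff.1 (hGa hA)).1, fun π hπ => ?_⟩
  -- The image of an edge lies in `𝒢`, hence is no non-edge; likewise `{0}` cannot go to the last
  -- vertex.
  refine perm_eq_one_of_path π (fun a b hab => ?_) fun h => ?_
  · have hmem : avoidLast {a, b} ∈ 𝒢 := by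
      refine hcG (Finset.mem_insert_of_mem (Finset.mem_image.2
        ⟨⟨a, by have := b.2; omega⟩, Finset.mem_univ _, ?_⟩))
      congr 3
      exact Fin.ext hab
    have hmem' := hπ _ hmem
    rw [hnorm, Finset.map_insert, Finset.map_singleton] at hmem'
    have hb := hGbad _ hmem'
    simp only [Equiv.coe_toEmbedding] at hb
    have hne : (π a : ℕ) ≠ π b := fun h => by
      have := congrArg Fin.val (π.injective (Fin.ext h))
      omega
    have c1 : ¬ (π a : ℕ) + 1 < π b := fun h => hb (hpair _ _ h)
    have c2 : ¬ (π b : ℕ) + 1 < π a := fun h => hb (by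
      rw [Finset.pair_comm]; exact hpair _ _ h)
    omega
  · have hmem := hπ _ (hcG (Finset.mem_insert_self _ _))
    rw [Finset.map_singleton] at hmem
    refine hGbad _ hmem ?_
    simp only [Equiv.coe_toEmbedding, h]
    exact Finset.mem_insert_self _ _

/-- A two-labeling of `Q_n` is distinguishing with a class of `M + 1` vertices, whenever
`M + 1 ≤ n ≤ 2 ^ (M - 1)`. -/
theorem exists_distinguishing_of_le {n M : ℕ} (hM : 4 ≤ M) (h1 : M + 1 ≤ n)
    (h2 : n ≤ 2 ^ (M - 1)) :
    ∃ c : (Fin n → Bool) → Fin 2, (hypercube n).IsDistinguishingLabeling c ∧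
      ∃ (i : Fin 2) (S : Finset (Fin n → Bool)), (∀ v, v ∈ S ↔ c v = i) ∧ S.card = M + 1 := by
  obtain ⟨𝒢, hG, hlast, hrigid⟩ := exists_rigid_family hM h1 h2
  let e := 𝒢.equivFinOfCardEq hG
  have hne : ∀ A ∈ 𝒢, ∀ B ∈ 𝒢, A ≠ Bᶜ := fun A hA B hB h =>
    hlast A hA (by rw [h]; simpa using hlast B hB)
  refine exists_distinguishing_of_columns (fun i => (e.symm i).1) (fun i j h => ?_)
    (fun i => hne _ (e.symm i).2 _ (e.symm i).2) fun π hπ => hrigid π fun A hA => ?_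
  · rcases h with h | h
    · exact e.symm.injective (Subtype.ext h)
    · exact absurd h (hne _ (e.symm i).2 _ (e.symm j).2)
  · obtain ⟨j, hj⟩ := hπ (e ⟨A, hA⟩)
    simp only [Equiv.symm_apply_apply] at hj
    rw [avoidLast_eq_avoidLast_iff.2 hj, avoidLast_of_notMem (hlast _ (e.symm j).2)]
    exact (e.symm j).2

/-! ### Comparing the cost with the determining number -/

/-- Fixing one class pointwise preserves its complement, which is the only other class. -/
theorem determiningNumber_le_card {V : Type*} {G : SimpleGraph V} {c : V → Fin 2}
    (hc : G.IsDistinguishingLabeling c) {i : Fin 2} {S : Finset V} (hS : ∀ v, v ∈ S ↔ c v = i) :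
    G.determiningNumber ≤ S.card := by
  refine Nat.sInf_le ⟨S, fun φ hφ => hc φ fun v => ?_, rfl⟩
  by_cases hv : v ∈ S
  · rw [hφ v hv]
  · have hv' : φ v ∉ S := fun h => hv (by
      have := φ.injective (hφ _ h)
      rwa [this] at h)
    rw [hS] at hv hv'
    omega

end SimpleGraph

theorem mainTheorem4 (n : ℕ) (hn : 5 ≤ n) :
    (SimpleGraph.hypercube n).IsDistinguishable 2 ∧
      ((SimpleGraph.hypercube n).distinguishingCost =
          (SimpleGraph.hypercube n).determiningNumber ∨
        (SimpleGraph.hypercube n).distinguishingCost =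
          (SimpleGraph.hypercube n).determiningNumber + 1) := by
  obtain ⟨m, hm⟩ : ∃ m, Nat.clog 2 n = m := ⟨_, rfl⟩
  have hle : n ≤ 2 ^ m := hm ▸ Nat.le_pow_clog one_lt_two n
  have hm3 : 3 ≤ m := by
    by_contra! h
    have : 2 ^ m ≤ 2 ^ 2 := Nat.pow_le_pow_right (by norm_num) (by omega)
    omega
  have hlt : m + 1 < n := by
    have h1 : 2 ^ (m - 1) < n := by
      have := Nat.pow_pred_clog_lt_self one_lt_two (x := n) (by omega)
      rwa [hm] at this
    have h2 : ∀ k, 2 ≤ k → k + 2 ≤ 2 ^ k := fun k hk => by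
      induction k, hk using Nat.le_induction with
      | base => norm_num
      | succ k hk ih => rw [pow_succ]; omega
    have := h2 (m - 1) (by omega)
    omega
  -- `M = m + 1` is the choice for which `2 ^ (M - 1) = 2 ^ m ≥ n`; the class has `m + 2` vertices.
  have hex := SimpleGraph.exists_distinguishing_of_le (n := n) (M := m + 1) (by omega) (by omega)
    (by simpa using hle)
  have hcost : (SimpleGraph.hypercube n).distinguishingCost ≤ m + 2 := Nat.sInf_le hex
  obtain ⟨c', hc', i', S', hS', hcard'⟩ := Nat.sInf_mem (s := {k |
    ∃ c : (Fin n → Bool) → Fin 2, (SimpleGraph.hypercube n).IsDistinguishingLabeling c ∧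
      ∃ (i : Fin 2) (S : Finset (Fin n → Bool)), (∀ v, v ∈ S ↔ c v = i) ∧ S.card = k}) ⟨_, hex⟩
  have hdet_le : (SimpleGraph.hypercube n).determiningNumber ≤
      (SimpleGraph.hypercube n).distinguishingCost :=
    (SimpleGraph.determiningNumber_le_card hc' hS').trans hcard'.le
  obtain ⟨T, hT, hTcard⟩ := Nat.sInf_mem (s := {k | ∃ S : Finset (Fin n → Bool),
    (∀ φ : SimpleGraph.hypercube n ≃g SimpleGraph.hypercube n, (∀ v ∈ S, φ v = v) →
      φ = RelIso.refl (SimpleGraph.hypercube n).Adj) ∧ S.card = k})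
    ⟨_, Finset.univ, fun φ hφ => RelIso.ext fun v => hφ v (Finset.mem_univ v), rfl⟩
  -- Here `m ≤ T.card - 1`, and `m ≥ 3` rules out truncated subtraction.
  have hdet : m + 1 ≤ (SimpleGraph.hypercube n).determiningNumber := by
    have h1 := SimpleGraph.le_two_pow_of_determining (by omega) T hT
    have h2 := (Nat.clog_le_iff_le_pow one_lt_two).2 h1
    rw [hm] at h2
    have h3 : T.card = (SimpleGraph.hypercube n).determiningNumber := hTcard
    omega
  obtain ⟨c, hc, -⟩ := hex
  exact ⟨⟨c, hc⟩, by omega⟩
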